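/- Let $n\ge 1$ be an integer, let $\alpha>-1$ be real, and for $x\in\mathbb R^n$, $y>0$ put $$\mathcal K_{\alpha,y}(x)=\mathcal K_\alpha(x,y)=\frac{\Gamma((\alpha+n+1)/2)}{\Gamma((\alpha+1)/2)\,\pi^{n/2}}\cdot\frac{y^{\alpha+1}}{(|x|^2+y^2)^{(\alpha+n+1)/2}}.$$ Let $I_\nu(z)=\sum_{m=0}^\infty \frac{(z/2)^{\nu+2m}}{m!\,\Gamma(\nu+m+1)}$ for real $\nu$ and $z>0$ (with $1/\Gamma=0$ at the poles of $\Gamma$), and let $K_\nu$ be the modified Bessel function of the third kind, that is, $K_\nu(z)=\frac{\pi}{2}\cdot\frac{I_{-\nu}(z)-I_\nu(z)}{\sin\nu\pi}$ for $\nu\notin\mathbb Z$, and $K_k(z)=\lim_{\nu\to k}K_\nu(z)$ for $k\in\mathbb Z$. Then for every $y>0$ the function $\mathcal K_{\alpha,y}$ is integrable on $\mathbb R^n$, and its Fourier transform $\widehat{\mathcal K_{\alpha,y}}(\xi)=\int_{\mathbb R^n} e^{-i\langle x,\xi\rangle}\mathcal K_{\alpha,y}(x)\,dx$ satisfies $$\widehat{\mathcal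 K_{\alpha,y}}(\xi)=\frac{2^{(1-\alpha)/2}}{\Gamma((\alpha+1)/2)}\,(y|\xi|)^{(\alpha+1)/2}\,K_{(\alpha+1)/2}(y|\xi|),\qquad \xi\in\mathbb R^n,$$ where for $\xi=0$ the right-hand side is understood as its limit: $\widehat{\mathcal K_{\alpha,y}}(0)=1$ and $\lim_{r\to0^+}\frac{2^{(1-\alpha)/2}}{\Gamma((\alpha+1)/2)}\,r^{(\alpha+1)/2}K_{(\alpha+1)/2}(r)=1$. -/

import Mathlib

open MeasureTheory Filter Topology

/-- The Poisson-type kernel `𝒦_α(x, y)` on the half space `ℝⁿ × (0, ∞)`. -/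
noncomputable def halfSpaceKernel (n : ℕ) (α : ℝ) (x : EuclideanSpace ℝ (Fin n)) (y : ℝ) : ℝ :=
  Real.Gamma ((α + n + 1) / 2) / (Real.Gamma ((α + 1) / 2) * Real.pi ^ ((n : ℝ) / 2)) *
    (y ^ (α + 1) / (‖x‖ ^ 2 + y ^ 2) ^ ((α + n + 1) / 2))

/-- The Fourier transform on `ℝⁿ` with the normalization `∫ e^{-i⟨x, ξ⟩} f(x) dx`. -/
noncomputable def angularFourier {n : ℕ} (f : EuclideanSpace ℝ (Fin n) → ℂ)
    (ξ : EuclideanSpace ℝ (Fin n)) : ℂ :=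
  ∫ x, Complex.exp (-(Complex.I * ((inner ℝ x ξ : ℝ) : ℂ))) * f x

/-- The modified Bessel function `I_ν(z) = ∑ₘ (z/2)^{ν+2m} / (m! Γ(ν+m+1))` of real order, for
`z > 0`. Mathlib's `Real.Gamma` is `0` at the poles of `Γ`, so by `a / 0 = 0` the terms in which
`ν + m + 1` is a nonpositive integer vanish, in accordance with `1 / Γ = 0` there. -/
noncomputable def modifiedBesselI (ν z : ℝ) : ℝ :=
  ∑' m : ℕ, (z / 2) ^ (ν + 2 * m) / (m.factorial * Real.Gamma (ν + m + 1))

/-- The quotient `(π / 2) (I_{-ν}(z) - I_ν(z)) / sin(νπ)`, meaningful for nonintegral `ν`. -/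
noncomputable def modifiedBesselKQuot (ν z : ℝ) : ℝ :=
  Real.pi / 2 * ((modifiedBesselI (-ν) z - modifiedBesselI ν z) / Real.sin (ν * Real.pi))

open Classical in
/-- The modified Bessel function `K_ν(z)` of the third kind, of real order, for `z > 0`: the
quotient above if `ν` is not an integer, and its limit as the order tends to `ν` if `ν` is. -/
noncomputable def modifiedBesselK (ν z : ℝ) : ℝ :=
  if ∃ k : ℤ, (k : ℝ) = ν then limUnder (𝓝[≠] ν) (fun μ => modifiedBesselKQuot μ z)
  else modifiedBesselKQuot ν z

/-! Put ν = (α+1)/2. By the Gamma integral the kernel is a mixture over t > 0 of Gaussians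
exp(-(|x|²+y²)t). Fubini and the Gaussian Fourier transform turn its transform into B(x)/Γ(ν) with
B(x) = ∫₀^∞ e^{-s-x/s} s^{ν-1} ds and x = (y|ξ|/2)² (`angularFourier_halfSpaceKernel`). Dominated
convergence at x = 0 gives the value and the limit at the origin.

It remains to identify B with K_ν, defined through I_{±ν} (`modifiedBesselK_eq`). For nonintegral ν,
expanding e^{-x/s} under the whole integral produces divergent terms. So the integral is cut at s =
1, and s = x/v turns the piece over (0,1) into a tail of order -ν starting at x. Each tail expands
in upper incomplete Gamma functions Γ(b-m, a) = Γ(b-m) - γ(b-m, a), with γ given by its power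
series. The two double series from γ cancel (`rpow_mul_tsum_lowerGammaTerm`), and the reflection
formula turns the remaining sums of Γ(±ν-m) into I_{-ν} and I_ν. Integral ν follows by continuity of
B in the order. -/

/-! ### Incomplete Gamma functions of nonintegral order -/

theorem exists_pos_le_abs_sub_intCast {b : ℝ} (hb : ∀ k : ℤ, (k : ℝ) ≠ b) :
    ∃ δ : ℝ, 0 < δ ∧ ∀ k : ℤ, δ ≤ |b - k| :=
  ⟨|b - round b|, abs_pos.2 (sub_ne_zero.2 (hb _).symm), fun k => round_le b k⟩

/-- The upper incomplete Gamma function `Γ(b, a)`. -/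
noncomputable def upperGamma (b a : ℝ) : ℝ := ∫ t in Set.Ioi a, Real.exp (-t) * t ^ (b - 1)

/-- The terms of the power series of the lower incomplete Gamma function `γ(b, a)`. -/
noncomputable def lowerGammaTerm (b a : ℝ) (j : ℕ) : ℝ :=
  (-1) ^ j * a ^ (b + j) / (j.factorial * (b + j))

theorem integrableOn_upperGamma (b : ℝ) {a : ℝ} (ha : 0 < a) :
    IntegrableOn (fun t : ℝ => Real.exp (-t) * t ^ (b - 1)) (Set.Ioi a) := by
  refine integrable_of_isBigO_exp_neg one_half_pos ?_ (Real.Gamma_integrand_isLittleO _).isBigO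
  refine ContinuousOn.mul (by fun_prop) (continuousOn_id.rpow_const fun t ht => Or.inl ?_)
  exact (ha.trans_le ht).ne'

theorem upperGamma_add_one (b : ℝ) {a : ℝ} (ha : 0 < a) :
    upperGamma (b + 1) a = b * upperGamma b a + a ^ b * Real.exp (-a) := by
  have h1 := integrableOn_upperGamma b ha
  have h2 := integrableOn_upperGamma (b + 1) ha
  have key : ∫ t in Set.Ioi a, (Real.exp (-t) * t ^ (b + 1 - 1)
      - b * (Real.exp (-t) * t ^ (b - 1))) = 0 - (-(a ^ b * Real.exp (-a))) := by
    refine integral_Ioi_of_hasDerivAt_of_tendsto' (f := fun t => -(t ^ b * Real.exp (-t)))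
      (fun t ht => ?_) (h2.sub (h1.const_mul b)) ?_
    · have ht0 : t ≠ 0 := (ha.trans_le ht).ne'
      have := ((Real.hasDerivAt_rpow_const (p := b) (Or.inl ht0)).mul
        ((hasDerivAt_neg t).exp)).neg
      refine this.congr_deriv ?_
      rw [add_sub_cancel_right]
      ring
    · have := (tendsto_rpow_mul_exp_neg_mul_atTop_nhds_zero b 1 one_pos).neg
      simpa using this
  rw [integral_sub h2 (h1.const_mul b), integral_const_mul] at key
  unfold upperGamma
  linarith

theorem norm_lowerGammaTerm_le {b δ : ℝ} (hδ : 0 < δ) (h : ∀ k : ℤ, δ ≤ |b - k|) {a : ℝ}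
    (ha : 0 < a) (j : ℕ) : ‖lowerGammaTerm b a j‖ ≤ a ^ b / δ * (a ^ j / j.factorial) := by
  have hj : δ ≤ |b + j| := by simpa using h (-(j : ℤ))
  have hf : (0 : ℝ) < j.factorial := by positivity
  rw [lowerGammaTerm, Real.norm_eq_abs, abs_div, abs_mul, abs_mul, abs_pow, abs_neg, abs_one,
    one_pow, one_mul, Nat.abs_cast, abs_of_pos (Real.rpow_pos_of_pos ha _), Real.rpow_add ha,
    Real.rpow_natCast, div_mul_div_comm, mul_comm δ]
  gcongr

theorem summable_lowerGammaTerm {b : ℝ} (hb : ∀ k : ℤ, (k : ℝ) ≠ b) {a : ℝ} (ha : 0 < a) :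
    Summable (lowerGammaTerm b a) := by
  obtain ⟨δ, hδ, h⟩ := exists_pos_le_abs_sub_intCast hb
  exact ((Real.summable_pow_div_factorial a).mul_left _).of_norm_bounded
    (norm_lowerGammaTerm_le hδ h ha)

theorem hasSum_exp_neg (a : ℝ) : HasSum (fun j : ℕ => (-a) ^ j / j.factorial) (Real.exp (-a)) := by
  rw [Real.exp_eq_exp_ℝ]
  exact NormedSpace.expSeries_div_hasSum_exp (-a)

theorem integral_Ioc_exp_neg_mul_rpow {b : ℝ} (hb : 0 < b) {a : ℝ} (ha : 0 < a) :
    ∫ t in Set.Ioc 0 a, Real.exp (-t) * t ^ (b - 1) = ∑' j, lowerGammaTerm b a j := by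
  have hint (j : ℕ) : IntegrableOn (fun t : ℝ => t ^ (b + j - 1)) (Set.Ioc 0 a) := by
    rw [← intervalIntegrable_iff_integrableOn_Ioc_of_le ha.le]
    exact intervalIntegral.intervalIntegrable_rpow' (by
      have : (0 : ℝ) ≤ j := j.cast_nonneg
      linarith)
  have hval (j : ℕ) : ∫ t in Set.Ioc 0 a, t ^ (b + j - 1) = a ^ (b + j) / (b + j) := by
    have hj : 0 < b + j := by positivity
    rw [← intervalIntegral.integral_of_le ha.le, integral_rpow (Or.inl (by linarith)),
      sub_add_cancel, Real.zero_rpow hj.ne', sub_zero]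
  have hF : ∀ j : ℕ, IntegrableOn
      (fun t : ℝ => (-1) ^ j / j.factorial * t ^ (b + j - 1)) (Set.Ioc 0 a) :=
    fun j => (hint j).const_mul _
  have key := hasSum_integral_of_summable_integral_norm hF ?_
  · refine Eq.trans (setIntegral_congr_fun measurableSet_Ioc fun t ht => ?_)
      (key.tsum_eq.symm.trans (tsum_congr fun j => ?_))
    · have h := (hasSum_exp_neg t).mul_right (t ^ (b - 1))
      rw [← h.tsum_eq]
      refine tsum_congr fun j => ?_
      rw [show b + j - 1 = (b - 1) + j by ring, Real.rpow_add ht.1, Real.rpow_natCast,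
        neg_pow t]
      ring
    · rw [integral_const_mul, hval, lowerGammaTerm, div_mul_div_comm]
  · have hn (j : ℕ) : ∫ t in Set.Ioc 0 a, ‖(-1) ^ j / (j.factorial : ℝ) * t ^ (b + j - 1)‖ =
        a ^ j / j.factorial * (a ^ b / (b + j)) := by
      rw [setIntegral_congr_fun (g := fun t : ℝ => 1 / (j.factorial : ℝ) * t ^ (b + j - 1))
        measurableSet_Ioc fun t ht => ?_, integral_const_mul, hval, Real.rpow_add ha,
        Real.rpow_natCast]
      · ring
      · have := Real.rpow_nonneg ht.1.le (b + j - 1)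
        simp [abs_of_nonneg this]
    simp_rw [hn]
    refine Summable.of_nonneg_of_le (fun j => by positivity) (fun j => ?_)
      ((Real.summable_pow_div_factorial a).mul_right (a ^ b / b))
    gcongr
    linarith [(j.cast_nonneg : (0 : ℝ) ≤ j)]

theorem upperGamma_of_pos {b : ℝ} (hb : 0 < b) {a : ℝ} (ha : 0 < a) :
    upperGamma b a = Real.Gamma b - ∑' j, lowerGammaTerm b a j := by
  have hI := Real.GammaIntegral_convergent hb
  rw [← integral_Ioc_exp_neg_mul_rpow hb ha, Real.Gamma_eq_integral hb,
    ← Set.Ioc_union_Ioi_eq_Ioi ha.le, setIntegral_union Set.Ioc_disjoint_Ioi_same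
    measurableSet_Ioi (hI.mono_set Set.Ioc_subset_Ioi_self)
    (hI.mono_set (Set.Ioi_subset_Ioi ha.le)), upperGamma]
  ring

/-- The series obeys the recurrence of γ(b, a), also where the integral for γ diverges; this carries
the splitting of Γ(b) to negative b. -/
theorem mul_tsum_lowerGammaTerm {b : ℝ} (hb : ∀ k : ℤ, (k : ℝ) ≠ b) {a : ℝ} (ha : 0 < a) :
    b * ∑' j, lowerGammaTerm b a j =
      a ^ b * Real.exp (-a) + ∑' j, lowerGammaTerm (b + 1) a j := by
  have hb1 : ∀ k : ℤ, (k : ℝ) ≠ b + 1 := fun k hk => hb (k - 1) (by push_cast; linarith)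
  have hs := summable_lowerGammaTerm hb ha
  have hs1 := summable_lowerGammaTerm hb1 ha
  have hexp := hasSum_exp_neg a
  have hne (j : ℕ) : b + j ≠ 0 := fun h => hb (-(j : ℤ)) (by push_cast; linarith)
  have hshift : HasSum (fun j : ℕ => a ^ b * ((-a) ^ j / j.factorial) - b * lowerGammaTerm b a j)
      (-∑' j, lowerGammaTerm (b + 1) a j) := by
    -- The factor 1 - b/(b+j) = j/(b+j) kills the term j = 0 and turns j!(b+j) into (j-1)!(b+j),
    -- hence the shift by one.
    rw [← hasSum_nat_add_iff' 1]
    convert hs1.hasSum.neg using 1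
    · ext j
      have h1 := hne (j + 1)
      have h2 : b + 1 + j ≠ 0 := by convert h1 using 1; push_cast; ring
      have hf : (j.factorial : ℝ) ≠ 0 := by positivity
      have hj : (j : ℝ) + 1 ≠ 0 := by positivity
      have e : b + ((j + 1 : ℕ) : ℝ) = b + 1 + j := by push_cast; ring
      rw [lowerGammaTerm, lowerGammaTerm, e, Nat.factorial_succ,
        show b + 1 + (j : ℝ) = b + ((j + 1 : ℕ) : ℝ) by push_cast; ring, Real.rpow_add ha,
        Real.rpow_natCast, neg_pow a]
      push_cast at h1 ⊢
      field_simp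
      ring
    · have := hne 0
      simp only [Nat.cast_zero, add_zero] at this
      simp [lowerGammaTerm]
      field_simp
      ring
  have := hshift.unique ((hexp.mul_left (a ^ b)).sub (hs.hasSum.mul_left b))
  linarith

theorem upperGamma_eq {b : ℝ} (hb : ∀ k : ℤ, (k : ℝ) ≠ b) {a : ℝ} (ha : 0 < a) :
    upperGamma b a = Real.Gamma b - ∑' j, lowerGammaTerm b a j := by
  -- n unit shifts make b positive, where the integral formula applies; each step back divides by b
  -- ≠ 0.
  obtain ⟨n, hn⟩ := exists_nat_gt (-b)
  induction n generalizing b with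
  | zero => exact upperGamma_of_pos (by simpa using hn) ha
  | succ n ih =>
    have hb1 : ∀ k : ℤ, (k : ℝ) ≠ b + 1 := fun k hk => hb (k - 1) (by push_cast; linarith)
    have hb0 : b ≠ 0 := fun h => hb 0 (by simp [h])
    have h := ih hb1 (by push_cast at hn; linarith)
    rw [upperGamma_add_one b ha, Real.Gamma_add_one hb0] at h
    have h2 := mul_tsum_lowerGammaTerm hb ha
    apply mul_left_cancel₀ hb0
    linarith

/-! ### Series expansion of the Bessel-type integral -/

/-- The integral `∫ₐ^∞ e^{-s - x/s} s^{b-1} ds`, with `a = 0` an integral of Bessel type. -/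
noncomputable def besselTail (b a x : ℝ) : ℝ :=
  ∫ s in Set.Ioi a, Real.exp (-s) * s ^ (b - 1) * Real.exp (-(x / s))

/-- Expand e^{-x/s} and integrate termwise: since s > a > 0, the series of (|x|/a)^m/m! dominates.
-/
theorem hasSum_besselTail (b x : ℝ) {a : ℝ} (ha : 0 < a) :
    HasSum (fun m : ℕ => (-x) ^ m / m.factorial * upperGamma (b - m) a) (besselTail b a x) := by
  have hint (m : ℕ) := integrableOn_upperGamma (b - m) ha
  have key := hasSum_integral_of_summable_integral_norm (μ := volume.restrict (Set.Ioi a))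
    (F := fun (m : ℕ) (s : ℝ) => (-x) ^ m / m.factorial * (Real.exp (-s) * s ^ (b - m - 1)))
    (fun m => (hint m).const_mul _) ?_
  · simp_rw [integral_const_mul] at key
    have heq : besselTail b a x = ∫ s in Set.Ioi a, ∑' m : ℕ,
        (-x) ^ m / m.factorial * (Real.exp (-s) * s ^ (b - m - 1)) := ?_
    · rw [heq]
      exact key
    refine setIntegral_congr_fun measurableSet_Ioi fun s hs => ?_
    have hs0 : 0 < s := ha.trans hs
    have h := (hasSum_exp_neg (x / s)).mul_left (Real.exp (-s) * s ^ (b - 1))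
    rw [← h.tsum_eq]
    refine tsum_congr fun m => ?_
    rw [show b - m - 1 = (b - 1) - m by ring, Real.rpow_sub hs0 (b - 1), Real.rpow_natCast, ← neg_div,
      div_pow]
    ring
  · refine Summable.of_nonneg_of_le (fun m => integral_nonneg fun s => norm_nonneg _)
      (fun m => ?_) ((Real.summable_pow_div_factorial (|x| / a)).mul_right (upperGamma b a))
    rw [upperGamma, ← integral_const_mul]
    refine setIntegral_mono_on ((hint m).const_mul _).norm
      ((integrableOn_upperGamma b ha).const_mul _) measurableSet_Ioi fun s hs => ?_
    have hs0 : 0 < s := ha.trans hs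
    have hp := Real.rpow_pos_of_pos hs0 (b - 1)
    rw [show b - m - 1 = (b - 1) - m by ring, Real.rpow_sub hs0 (b - 1), Real.rpow_natCast,
      Real.norm_eq_abs, abs_mul, abs_div, abs_pow, abs_neg, Nat.abs_cast,
      abs_of_pos (show 0 < Real.exp (-s) * (s ^ (b - 1) / s ^ m) by positivity), div_pow]
    have : |x| ^ m / s ^ m ≤ |x| ^ m / a ^ m := by
      gcongr
      exact le_of_lt hs
    calc _ = |x| ^ m / s ^ m * (Real.exp (-s) * s ^ (b - 1) / m.factorial) := by ring
      _ ≤ |x| ^ m / a ^ m * (Real.exp (-s) * s ^ (b - 1) / m.factorial) := by gcongr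
      _ = _ := by ring

/-- The distance from b to ℤ bounds all denominators b-m+j from below at once, so a product of two
exponential series dominates. -/
theorem summable_besselTail_lowerGammaTerm {b : ℝ} (hb : ∀ k : ℤ, (k : ℝ) ≠ b) (x : ℝ) {a : ℝ}
    (ha : 0 < a) : Summable (fun p : ℕ × ℕ =>
      (-x) ^ p.1 / p.1.factorial * lowerGammaTerm (b - p.1) a p.2) := by
  obtain ⟨δ, hδ, h⟩ := exists_pos_le_abs_sub_intCast hb
  have hs := ((Real.summable_pow_div_factorial (|x| / a)).mul_of_nonneg
    (Real.summable_pow_div_factorial a) (fun m => by positivity)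
    (fun m => by positivity)).mul_left (a ^ b / δ)
  refine hs.of_norm_bounded fun p => ?_
  have h' (k : ℤ) : δ ≤ |b - p.1 - k| := by
    have := h (p.1 + k)
    push_cast at this
    rwa [← sub_sub] at this
  rw [norm_mul, norm_div, norm_pow, norm_neg, Real.norm_eq_abs, Real.norm_eq_abs, Nat.abs_cast]
  calc _ ≤ |x| ^ p.1 / p.1.factorial * (a ^ (b - p.1) / δ * (a ^ p.2 / p.2.factorial)) := by
        gcongr
        exact norm_lowerGammaTerm_le hδ h' ha p.2
    _ = _ := by
        rw [Real.rpow_sub ha, Real.rpow_natCast, div_pow]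
        ring

theorem hasSum_mul_Gamma_sub {b : ℝ} (hb : ∀ k : ℤ, (k : ℝ) ≠ b) (x : ℝ) {a : ℝ} (ha : 0 < a) :
    HasSum (fun m : ℕ => (-x) ^ m / m.factorial * Real.Gamma (b - m))
      (besselTail b a x + ∑' p : ℕ × ℕ,
        (-x) ^ p.1 / p.1.factorial * lowerGammaTerm (b - p.1) a p.2) := by
  have hb' (m : ℕ) : ∀ k : ℤ, (k : ℝ) ≠ b - m :=
    fun k hk => hb (k + m) (by push_cast; linarith)
  have h : HasSum (fun m : ℕ => (-x) ^ m / m.factorial * ∑' j, lowerGammaTerm (b - m) a j)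
      (∑' p : ℕ × ℕ, (-x) ^ p.1 / p.1.factorial * lowerGammaTerm (b - p.1) a p.2) :=
    (summable_besselTail_lowerGammaTerm hb x ha).hasSum.prod_fiberwise
      fun m => (summable_lowerGammaTerm (hb' m) ha).hasSum.mul_left ((-x) ^ m / m.factorial)
  refine ((hasSum_besselTail b x ha).add h).congr_fun fun m => ?_
  rw [upperGamma_eq (hb' m) ha]
  ring

/-- Swap the two indices: the denominators satisfy -ν-m+j = -(ν-j+m), and the powers of x match
because the second tail starts at a = x. -/
theorem rpow_mul_tsum_lowerGammaTerm (ν : ℝ) {x : ℝ} (hx : 0 < x) :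
    x ^ ν * ∑' p : ℕ × ℕ, (-x) ^ p.1 / p.1.factorial * lowerGammaTerm (-ν - p.1) x p.2 =
      -∑' p : ℕ × ℕ, (-x) ^ p.1 / p.1.factorial * lowerGammaTerm (ν - p.1) 1 p.2 := by
  rw [← tsum_mul_left, ← tsum_neg,
    ← (Equiv.prodComm ℕ ℕ).tsum_eq fun p : ℕ × ℕ =>
      -((-x) ^ p.1 / p.1.factorial * lowerGammaTerm (ν - p.1) 1 p.2)]
  refine tsum_congr fun p => ?_
  simp only [Equiv.prodComm_apply, Prod.fst_swap, Prod.snd_swap, lowerGammaTerm, Real.one_rpow]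
  have hx0 := (Real.rpow_pos_of_pos hx ν).ne'
  rw [show -ν - p.1 + p.2 = -(ν - p.2 + p.1) by ring, Real.rpow_neg hx.le, Real.rpow_add hx,
    Real.rpow_sub hx, Real.rpow_natCast, Real.rpow_natCast, neg_pow x p.1, neg_pow x p.2]
  have h1 := hx.ne'
  generalize ν - p.2 + p.1 = w
  have e : x ^ ν * ((-1) ^ p.1 * x ^ p.1 / p.1.factorial *
      ((-1) ^ p.2 * (x ^ ν / x ^ p.2 * x ^ p.1)⁻¹ / (p.2.factorial * -w))) =
      x ^ ν * (x ^ ν)⁻¹ * (x ^ p.1 * (x ^ p.1)⁻¹) *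
      ((-1) ^ p.1 / p.1.factorial * ((-1) ^ p.2 * x ^ p.2 / (p.2.factorial * -w))) := by
    rw [mul_inv, inv_div]
    ring
  rw [e, mul_inv_cancel₀ hx0, mul_inv_cancel₀ (pow_ne_zero _ h1), mul_neg, div_neg]
  ring

theorem integrableOn_besselTail {ν : ℝ} (hν : 0 < ν) {x : ℝ} (hx : 0 ≤ x) :
    IntegrableOn (fun s : ℝ => Real.exp (-s) * s ^ (ν - 1) * Real.exp (-(x / s)))
      (Set.Ioi 0) := by
  refine (Real.GammaIntegral_convergent hν).mono' (by measurability) ?_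
  filter_upwards [ae_restrict_mem measurableSet_Ioi] with s hs
  have hs0 : 0 < s := hs
  have hp := Real.rpow_pos_of_pos hs0 (ν - 1)
  rw [Real.norm_eq_abs, abs_of_pos (by positivity)]
  exact mul_le_of_le_one_right (by positivity)
    (Real.exp_le_one_iff.2 (neg_nonpos.2 (div_nonneg hx hs0.le)))

theorem integral_Ioo_bessel (ν : ℝ) {x : ℝ} (hx : 0 < x) :
    ∫ s in Set.Ioo 0 1, Real.exp (-s) * s ^ (ν - 1) * Real.exp (-(x / s)) =
      x ^ ν * besselTail (-ν) x x := by
  have himage : (fun v => x / v) '' Set.Ioi x = Set.Ioo 0 1 := by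
    ext s
    constructor
    · rintro ⟨v, hv, rfl⟩
      have hv0 : 0 < v := hx.trans hv
      exact ⟨div_pos hx hv0, (div_lt_one hv0).2 hv⟩
    · rintro ⟨h0, h1⟩
      exact ⟨x / s, (lt_div_iff₀ h0).2 (mul_lt_of_lt_one_right hx h1), by
        simp [hx.ne']⟩
  rw [← himage, integral_image_eq_integral_abs_deriv_smul (f' := fun v => -x / v ^ 2)
    measurableSet_Ioi, besselTail, ← integral_const_mul]
  · refine setIntegral_congr_fun measurableSet_Ioi fun v hv => ?_
    have hv0 : 0 < v := hx.trans hv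
    have hxv : x / (x / v) = v := by field_simp
    have h1 := (Real.rpow_pos_of_pos hv0 ν).ne'
    simp only [hxv, smul_eq_mul, neg_div, abs_neg]
    rw [abs_of_pos (by positivity), Real.div_rpow hx.le hv0.le, Real.rpow_sub_one hx.ne',
      Real.rpow_sub_one hv0.ne', Real.rpow_sub_one hv0.ne', Real.rpow_neg hv0.le]
    field_simp
  · intro v hv
    have hv0 : v ≠ 0 := (hx.trans hv).ne'
    have := ((hasDerivAt_inv hv0).const_mul x).hasDerivWithinAt (s := Set.Ioi x)
    simp only [← div_eq_mul_inv] at this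
    exact this.congr_deriv (by ring)
  · intro u hu v hv huv
    have hu0 : u ≠ 0 := (hx.trans hu).ne'
    have hv0 : v ≠ 0 := (hx.trans hv).ne'
    have := hx.ne'
    simp only at huv
    field_simp at huv
    exact huv.symm

theorem besselTail_zero_eq_add {ν : ℝ} (hν : 0 < ν) {x : ℝ} (hx : 0 < x) :
    besselTail ν 0 x = besselTail ν 1 x + x ^ ν * besselTail (-ν) x x := by
  have hI := integrableOn_besselTail hν hx.le
  rw [← integral_Ioo_bessel ν hx, ← integral_Ioc_eq_integral_Ioo, besselTail, besselTail,
    ← Set.Ioc_union_Ioi_eq_Ioi zero_le_one, setIntegral_union Set.Ioc_disjoint_Ioi_same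
    measurableSet_Ioi (hI.mono_set Set.Ioc_subset_Ioi_self)
    (hI.mono_set (Set.Ioi_subset_Ioi zero_le_one)), add_comm]

theorem besselTail_zero_eq_tsum {ν : ℝ} (hν : 0 < ν) (hν' : ∀ k : ℤ, (k : ℝ) ≠ ν) {x : ℝ}
    (hx : 0 < x) : besselTail ν 0 x =
      ∑' m : ℕ, (-x) ^ m / m.factorial * Real.Gamma (ν - m) +
        x ^ ν * ∑' m : ℕ, (-x) ^ m / m.factorial * Real.Gamma (-ν - m) := by
  have hneg : ∀ k : ℤ, (k : ℝ) ≠ -ν := fun k hk => hν' (-k) (by push_cast; linarith)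
  rw [(hasSum_mul_Gamma_sub hν' x one_pos).tsum_eq, (hasSum_mul_Gamma_sub hneg x hx).tsum_eq,
    mul_add, rpow_mul_tsum_lowerGammaTerm ν hx, besselTail_zero_eq_add hν hx]
  ring

/-! ### Identification with the modified Bessel function K_ν -/

theorem sin_mul_pi_ne_zero {ν : ℝ} (hν : ∀ k : ℤ, (k : ℝ) ≠ ν) : Real.sin (ν * Real.pi) ≠ 0 := by
  rw [Ne, Real.sin_eq_zero_iff]
  rintro ⟨k, hk⟩
  exact hν k (mul_right_cancel₀ Real.pi_ne_zero hk)

/-- Euler's reflection formula at ν-m, with sin((ν-m)π) = (-1)^m sin(νπ). -/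
theorem pi_div_sin_div_Gamma {ν : ℝ} (hν : ∀ k : ℤ, (k : ℝ) ≠ ν) (m : ℕ) :
    Real.pi / Real.sin (ν * Real.pi) / Real.Gamma (-ν + m + 1) =
      (-1) ^ m * Real.Gamma (ν - m) := by
  have hs := sin_mul_pi_ne_zero hν
  have h := Real.Gamma_mul_Gamma_one_sub (ν - m)
  have hG : Real.Gamma (-ν + m + 1) ≠ 0 := Real.Gamma_ne_zero fun k hk =>
    hν (m + 1 + k) (by push_cast; linarith)
  rw [show (1 : ℝ) - (ν - m) = -ν + m + 1 by ring, mul_comm Real.pi, sub_mul,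
    Real.sin_sub_nat_mul_pi] at h
  rw [div_eq_iff hG, mul_assoc, h]
  rcases neg_one_pow_eq_or ℝ m with e | e <;> rw [e] <;> field_simp

theorem modifiedBesselI_neg_eq {ν : ℝ} (hν : ∀ k : ℤ, (k : ℝ) ≠ ν) {z : ℝ} (hz : 0 < z) :
    Real.pi / Real.sin (ν * Real.pi) * modifiedBesselI (-ν) z =
      (z / 2) ^ (-ν) * ∑' m : ℕ, (-(z / 2) ^ 2) ^ m / m.factorial * Real.Gamma (ν - m) := by
  rw [modifiedBesselI, ← tsum_mul_left, ← tsum_mul_left]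
  refine tsum_congr fun m => ?_
  have h := pi_div_sin_div_Gamma hν m
  have e : (z / 2) ^ (-ν + 2 * m) = (z / 2) ^ (-ν) * ((z / 2) ^ 2) ^ m := by
    rw [Real.rpow_add (by positivity), ← pow_mul, ← Real.rpow_natCast _ (2 * m)]
    push_cast
    rfl
  rw [e, neg_pow ((z / 2) ^ 2)]
  calc _ = Real.pi / Real.sin (ν * Real.pi) / Real.Gamma (-ν + m + 1) *
        ((z / 2) ^ (-ν) * ((z / 2) ^ 2) ^ m / m.factorial) := by
        rw [div_mul_eq_div_div]; ring
    _ = _ := by rw [h]; ring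

theorem modifiedBesselKQuot_eq {ν : ℝ} (hν : 0 < ν) (hν' : ∀ k : ℤ, (k : ℝ) ≠ ν) {z : ℝ}
    (hz : 0 < z) :
    modifiedBesselKQuot ν z = (z / 2) ^ (-ν) / 2 * besselTail ν 0 ((z / 2) ^ 2) := by
  have hz2 : 0 < z / 2 := by positivity
  have hneg : ∀ k : ℤ, (k : ℝ) ≠ -ν := fun k hk => hν' (-k) (by push_cast; linarith)
  have h1 := modifiedBesselI_neg_eq hν' hz
  -- Order -ν yields I_ν; the oddness of the sine supplies the minus sign in the definition of K_ν.
  have h2 := modifiedBesselI_neg_eq hneg hz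
  rw [neg_neg, neg_mul, Real.sin_neg, div_neg, neg_mul] at h2
  have e : (z / 2) ^ (-ν) * ((z / 2) ^ 2) ^ ν = (z / 2) ^ ν := by
    rw [← Real.rpow_natCast, ← Real.rpow_mul hz2.le, ← Real.rpow_add hz2]
    congr 1
    push_cast
    ring
  rw [besselTail_zero_eq_tsum hν hν' (by positivity), modifiedBesselKQuot]
  calc _ = (Real.pi / Real.sin (ν * Real.pi) * modifiedBesselI (-ν) z +
        -(Real.pi / Real.sin (ν * Real.pi) * modifiedBesselI ν z)) / 2 := by ring
    _ = _ := by
      rw [h1, h2, ← e]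
      ring

theorem continuousAt_besselTail_order {ν : ℝ} (hν : 0 < ν) {x : ℝ} (hx : 0 ≤ x) :
    ContinuousAt (fun μ => besselTail μ 0 x) ν := by
  have hnhds : ∀ᶠ μ in 𝓝 ν, μ ∈ Set.Ioo (ν / 2) (2 * ν) :=
    Ioo_mem_nhds (by linarith) (by linarith)
  -- For ν/2 < μ < 2ν the first summand dominates when s ≤ 1, the second when s ≥ 1.
  refine continuousAt_of_dominated (bound := fun s =>
      Real.exp (-s) * s ^ (ν / 2 - 1) + Real.exp (-s) * s ^ (2 * ν - 1)) ?_ ?_ ?_ ?_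
  · filter_upwards [hnhds] with μ hμ
    exact (integrableOn_besselTail (by linarith [hμ.1]) hx).aestronglyMeasurable
  · filter_upwards [hnhds] with μ hμ
    filter_upwards [ae_restrict_mem measurableSet_Ioi] with s hs
    have hs0 : 0 < s := hs
    have hp := Real.rpow_pos_of_pos hs0 (μ - 1)
    have h1 := Real.rpow_pos_of_pos hs0 (ν / 2 - 1)
    have h2 := Real.rpow_pos_of_pos hs0 (2 * ν - 1)
    rw [Real.norm_eq_abs, abs_of_pos (by positivity), ← mul_add]
    refine (mul_le_of_le_one_right (by positivity) (Real.exp_le_one_iff.2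
      (neg_nonpos.2 (div_nonneg hx hs0.le)))).trans ?_
    gcongr
    rcases le_total s 1 with h | h
    · have := Real.rpow_le_rpow_of_exponent_ge hs0 h (show ν / 2 - 1 ≤ μ - 1 by linarith [hμ.1])
      linarith
    · have := Real.rpow_le_rpow_of_exponent_le h (show μ - 1 ≤ 2 * ν - 1 by linarith [hμ.2])
      linarith
  · exact (Real.GammaIntegral_convergent (by linarith)).add
      (Real.GammaIntegral_convergent (by linarith))
  · filter_upwards [ae_restrict_mem measurableSet_Ioi] with s hs
    have hs0 : s ≠ 0 := (Set.mem_Ioi.1 hs).ne'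
    exact ((continuousAt_const.mul ((Real.continuousAt_const_rpow hs0).comp
      (continuousAt_id.sub continuousAt_const))).mul continuousAt_const)

/-- Ensures that the limit defining K_k only involves orders where the quotient formula is valid. -/
theorem eventually_ne_intCast (ν : ℝ) : ∀ᶠ μ in 𝓝[≠] ν, ∀ k : ℤ, (k : ℝ) ≠ μ := by
  have hclosed : IsClosed ((Set.range ((↑) : ℤ → ℝ)) \ {ν}) := by
    have := Int.isClosedEmbedding_coe_real.isClosedMap
      (((↑) : ℤ → ℝ) ⁻¹' {ν})ᶜ (isClosed_discrete _)
    convert this using 1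
    ext t
    constructor
    · rintro ⟨⟨k, rfl⟩, hk⟩
      exact ⟨k, hk, rfl⟩
    · rintro ⟨k, hk, rfl⟩
      exact ⟨⟨k, rfl⟩, hk⟩
  have h : ∀ᶠ μ in 𝓝 ν, μ ∉ (Set.range ((↑) : ℤ → ℝ)) \ {ν} :=
    hclosed.isOpen_compl.mem_nhds (by simp)
  filter_upwards [h.filter_mono nhdsWithin_le_nhds, self_mem_nhdsWithin] with μ h1 h2 k hk
  exact h1 ⟨⟨k, hk⟩, h2⟩

theorem modifiedBesselK_eq {ν : ℝ} (hν : 0 < ν) {z : ℝ} (hz : 0 < z) :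
    modifiedBesselK ν z = (z / 2) ^ (-ν) / 2 * besselTail ν 0 ((z / 2) ^ 2) := by
  unfold modifiedBesselK
  split_ifs with h
  · refine Tendsto.limUnder_eq ?_
    have hc : ContinuousAt
        (fun μ => (z / 2) ^ (-μ) / 2 * besselTail μ 0 ((z / 2) ^ 2)) ν :=
      (((Real.continuousAt_const_rpow (by positivity)).comp continuousAt_neg).div_const 2).mul
        (continuousAt_besselTail_order hν (by positivity))
    refine (hc.tendsto.mono_left nhdsWithin_le_nhds).congr' ?_
    filter_upwards [eventually_ne_intCast ν,
      (lt_mem_nhds hν).filter_mono nhdsWithin_le_nhds] with μ h1 h2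
    exact (modifiedBesselKQuot_eq h2 h1 hz).symm
  · exact modifiedBesselKQuot_eq hν (fun k hk => h ⟨k, hk⟩) hz

theorem besselTail_zero_zero {ν : ℝ} (hν : 0 < ν) : besselTail ν 0 0 = Real.Gamma ν := by
  simp [besselTail, Real.Gamma_eq_integral hν]

theorem tendsto_besselTail_zero {ν : ℝ} (hν : 0 < ν) :
    Tendsto (besselTail ν 0) (𝓝[≥] 0) (𝓝 (Real.Gamma ν)) := by
  rw [← besselTail_zero_zero hν]
  refine tendsto_integral_filter_of_dominated_convergence
    (fun s => Real.exp (-s) * s ^ (ν - 1)) ?_ ?_ (Real.GammaIntegral_convergent hν) ?_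
  · filter_upwards [self_mem_nhdsWithin] with x hx
    exact (integrableOn_besselTail hν hx).aestronglyMeasurable
  · filter_upwards [self_mem_nhdsWithin] with x hx
    filter_upwards [ae_restrict_mem measurableSet_Ioi] with s hs
    have hs0 : 0 < s := hs
    have hp := Real.rpow_pos_of_pos hs0 (ν - 1)
    rw [Real.norm_eq_abs, abs_of_pos (by positivity)]
    exact mul_le_of_le_one_right (by positivity)
      (Real.exp_le_one_iff.2 (neg_nonpos.2 (div_nonneg hx hs0.le)))
  · refine Eventually.of_forall fun s => Tendsto.mono_left ?_ nhdsWithin_le_nhds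
    have : Continuous fun x : ℝ => Real.exp (-s) * s ^ (ν - 1) * Real.exp (-(x / s)) := by
      fun_prop
    exact this.tendsto 0

theorem two_rpow_mul_modifiedBesselK {ν : ℝ} (hν : 0 < ν) {r : ℝ} (hr : 0 < r) :
    2 ^ (1 - ν) / Real.Gamma ν * r ^ ν * modifiedBesselK ν r =
      besselTail ν 0 ((r / 2) ^ 2) / Real.Gamma ν := by
  have h1 := (Real.rpow_pos_of_pos hr ν).ne'
  have h2 := (Real.rpow_pos_of_pos two_pos ν).ne'
  rw [modifiedBesselK_eq hν hr, Real.rpow_neg (by positivity), Real.div_rpow hr.le zero_le_two,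
    Real.rpow_sub two_pos, Real.rpow_one]
  field_simp

theorem tendsto_two_rpow_mul_modifiedBesselK {ν : ℝ} (hν : 0 < ν) :
    Tendsto (fun r : ℝ => 2 ^ (1 - ν) / Real.Gamma ν * r ^ ν * modifiedBesselK ν r)
      (𝓝[>] 0) (𝓝 1) := by
  have hsq : Tendsto (fun r : ℝ => (r / 2) ^ 2) (𝓝[>] 0) (𝓝[≥] 0) := by
    refine tendsto_nhdsWithin_iff.2 ⟨?_, Eventually.of_forall fun r => Set.mem_Ici.2 (sq_nonneg _)⟩
    have : Continuous fun r : ℝ => (r / 2) ^ 2 := by fun_prop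
    simpa using (this.tendsto 0).mono_left nhdsWithin_le_nhds
  have h := ((tendsto_besselTail_zero hν).comp hsq).div_const (Real.Gamma ν)
  rw [div_self (Real.Gamma_pos_of_pos hν).ne'] at h
  refine h.congr' ?_
  filter_upwards [self_mem_nhdsWithin] with r hr
  exact (two_rpow_mul_modifiedBesselK hν hr).symm

/-! ### Gaussian mixtures and the Fourier transform -/

theorem integral_gaussian_mixture (n : ℕ) {ν y : ℝ} (hν : 0 < ν) (hy : 0 < y)
    (x : EuclideanSpace ℝ (Fin n)) :
    ∫ t in Set.Ioi (0 : ℝ), t ^ (ν + n / 2 - 1) * Real.exp (-((‖x‖ ^ 2 + y ^ 2) * t)) =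
      Real.Gamma (ν + n / 2) / (‖x‖ ^ 2 + y ^ 2) ^ (ν + n / 2) := by
  rw [Real.integral_rpow_mul_exp_neg_mul_Ioi (by positivity) (by positivity), one_div,
    Real.inv_rpow (by positivity)]
  ring

theorem integral_exp_neg_mul_add (n : ℕ) (y : ℝ) {t : ℝ} (ht : 0 < t) :
    ∫ x : EuclideanSpace ℝ (Fin n), Real.exp (-((‖x‖ ^ 2 + y ^ 2) * t)) =
      Real.exp (-(y ^ 2 * t)) * (Real.pi / t) ^ ((n : ℝ) / 2) := by
  have h := GaussianFourier.integral_rexp_neg_mul_sq_norm (V := EuclideanSpace ℝ (Fin n)) ht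
  rw [finrank_euclideanSpace_fin] at h
  rw [← h, ← integral_const_mul]
  refine integral_congr_ae (Eventually.of_forall fun x => ?_)
  simp only
  rw [← Real.exp_add]
  ring_nf

theorem integrable_exp_neg_mul_add (n : ℕ) (y : ℝ) {t : ℝ} (ht : 0 < t) :
    Integrable fun x : EuclideanSpace ℝ (Fin n) => Real.exp (-((‖x‖ ^ 2 + y ^ 2) * t)) := by
  -- The integral of a nonintegrable function is 0 by convention, so a nonzero value proves
  -- integrability.
  refine Integrable.of_integral_ne_zero ?_
  rw [integral_exp_neg_mul_add n y ht]
  have := Real.pi_pos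
  positivity

/-- The Gaussian mass (π/t)^{n/2} absorbs t^{n/2}; this is why the transform depends on n only
through |ξ|. -/
theorem rpow_mul_pi_div_rpow (ν : ℝ) (n : ℕ) {t : ℝ} (ht : 0 < t) :
    t ^ (ν + n / 2 - 1) * (Real.pi / t) ^ ((n : ℝ) / 2) =
      Real.pi ^ ((n : ℝ) / 2) * t ^ (ν - 1) := by
  have h := (Real.rpow_pos_of_pos ht ((n : ℝ) / 2)).ne'
  rw [show ν + (n : ℝ) / 2 - 1 = (ν - 1) + n / 2 by ring, Real.rpow_add ht,
    Real.div_rpow Real.pi_pos.le ht.le]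
  field_simp

theorem integrable_gaussian_mixture (n : ℕ) {ν y : ℝ} (hν : 0 < ν) (hy : 0 < y) :
    Integrable (fun p : EuclideanSpace ℝ (Fin n) × ℝ =>
      p.2 ^ (ν + n / 2 - 1) * Real.exp (-((‖p.1‖ ^ 2 + y ^ 2) * p.2)))
      (volume.prod (volume.restrict (Set.Ioi 0))) := by
  have hmeas : Measurable (fun p : EuclideanSpace ℝ (Fin n) × ℝ =>
      p.2 ^ (ν + n / 2 - 1) * Real.exp (-((‖p.1‖ ^ 2 + y ^ 2) * p.2))) := by fun_prop
  rw [integrable_prod_iff' hmeas.aestronglyMeasurable]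
  constructor
  · filter_upwards [ae_restrict_mem measurableSet_Ioi] with t ht
    exact (integrable_exp_neg_mul_add n y ht).const_mul _
  · have h := (integrableOn_rpow_mul_exp_neg_mul_rpow (p := 1) (s := ν - 1) (b := y ^ 2)
      (by linarith) one_pos (by positivity)).const_mul (Real.pi ^ ((n : ℝ) / 2))
    refine h.congr ?_
    filter_upwards [ae_restrict_mem measurableSet_Ioi] with t ht
    have ht0 : 0 < t := ht
    have hp := Real.rpow_pos_of_pos ht0 (ν + n / 2 - 1)
    have hn (x : EuclideanSpace ℝ (Fin n)) :
        ‖t ^ (ν + n / 2 - 1) * Real.exp (-((‖x‖ ^ 2 + y ^ 2) * t))‖ =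
          t ^ (ν + n / 2 - 1) * Real.exp (-((‖x‖ ^ 2 + y ^ 2) * t)) :=
      Real.norm_of_nonneg (by positivity)
    simp_rw [hn]
    rw [integral_const_mul, integral_exp_neg_mul_add n y ht0, mul_left_comm (t ^ (ν + n / 2 - 1)),
      rpow_mul_pi_div_rpow ν n ht0, Real.rpow_one, neg_mul]
    ring

theorem halfSpaceKernel_eq_integral (n : ℕ) {α y : ℝ} (hα : -1 < α) (hy : 0 < y)
    (x : EuclideanSpace ℝ (Fin n)) :
    halfSpaceKernel n α x y =
      y ^ (α + 1) / (Real.Gamma ((α + 1) / 2) * Real.pi ^ ((n : ℝ) / 2)) *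
        ∫ t in Set.Ioi (0 : ℝ),
          t ^ ((α + 1) / 2 + n / 2 - 1) * Real.exp (-((‖x‖ ^ 2 + y ^ 2) * t)) := by
  rw [integral_gaussian_mixture n (by linarith) hy, halfSpaceKernel,
    show (α + n + 1) / 2 = (α + 1) / 2 + (n : ℝ) / 2 by ring]
  ring

theorem integrable_halfSpaceKernel (n : ℕ) {α y : ℝ} (hα : -1 < α) (hy : 0 < y) :
    Integrable (fun x : EuclideanSpace ℝ (Fin n) => halfSpaceKernel n α x y) := by
  simp_rw [halfSpaceKernel_eq_integral n hα hy]
  exact (integrable_gaussian_mixture n (by linarith : 0 < (α + 1) / 2) hy).integral_prod_left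
    |>.const_mul _

theorem integral_cexp_inner_mul_exp_neg_mul_add (n : ℕ) (y : ℝ) {t : ℝ} (ht : 0 < t)
    (ξ : EuclideanSpace ℝ (Fin n)) :
    ∫ x : EuclideanSpace ℝ (Fin n), Complex.exp (-(Complex.I * ((inner ℝ x ξ : ℝ) : ℂ))) *
        ((Real.exp (-((‖x‖ ^ 2 + y ^ 2) * t)) : ℝ) : ℂ) =
      ((Real.exp (-(y ^ 2 * t)) * ((Real.pi / t) ^ ((n : ℝ) / 2) *
        Real.exp (-(‖ξ‖ ^ 2 / (4 * t)))) : ℝ) : ℂ) := by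
  have h := GaussianFourier.integral_cexp_neg_mul_sq_norm_add
    (V := EuclideanSpace ℝ (Fin n)) (b := (t : ℂ)) (by simpa using ht) (-Complex.I) ξ
  rw [finrank_euclideanSpace_fin] at h
  have e : ((Real.pi : ℂ) / t) ^ ((n : ℂ) / 2) * Complex.exp ((-Complex.I) ^ 2 * ‖ξ‖ ^ 2 / (4 * t))
      = (((Real.pi / t) ^ ((n : ℝ) / 2) * Real.exp (-(‖ξ‖ ^ 2 / (4 * t))) : ℝ) : ℂ) := by
    rw [Complex.ofReal_mul, Complex.ofReal_cpow (by positivity)]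
    push_cast
    rw [neg_sq, Complex.I_sq]
    ring_nf
  rw [Complex.ofReal_mul, ← e, ← h, ← integral_const_mul]
  refine integral_congr_ae (Eventually.of_forall fun x => ?_)
  simp only
  rw [Complex.ofReal_exp, Complex.ofReal_exp, ← Complex.exp_add, ← Complex.exp_add,
    real_inner_comm]
  congr 1
  push_cast
  ring

theorem integral_rpow_mul_exp_neg_mul_exp_neg_div (ν : ℝ) {y : ℝ} (hy : 0 < y) (ρ : ℝ) :
    ∫ t in Set.Ioi (0 : ℝ), t ^ (ν - 1) * Real.exp (-(y ^ 2 * t)) * Real.exp (-(ρ ^ 2 / (4 * t))) =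
      y ^ (-(2 * ν)) * besselTail ν 0 ((y * ρ / 2) ^ 2) := by
  have hy2 : 0 < y ^ 2 := by positivity
  -- Substitution s = y²t.
  have h := integral_comp_mul_left_Ioi (fun s : ℝ => Real.exp (-s) * s ^ (ν - 1) *
    Real.exp (-((y * ρ / 2) ^ 2 / s))) 0 hy2
  rw [mul_zero, smul_eq_mul] at h
  have hp : y ^ (-(2 * ν)) = (y ^ 2)⁻¹ * ((y ^ 2) ^ (ν - 1))⁻¹ := by
    rw [← mul_inv, Real.rpow_sub_one hy2.ne', mul_div_cancel₀ _ hy2.ne', Real.rpow_neg hy.le,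
      ← Real.rpow_natCast, ← Real.rpow_mul hy.le]
    norm_cast
  rw [hp, mul_right_comm, besselTail, ← h, mul_comm, ← integral_const_mul]
  refine setIntegral_congr_fun measurableSet_Ioi fun t ht => ?_
  have ht0 : 0 < t := ht
  have h1 := (Real.rpow_pos_of_pos hy2 (ν - 1)).ne'
  rw [Real.mul_rpow hy2.le ht0.le,
    show (y * ρ / 2) ^ 2 / (y ^ 2 * t) = ρ ^ 2 / (4 * t) by field_simp; norm_num]
  field_simp

theorem angularFourier_halfSpaceKernel (n : ℕ) {α y : ℝ} (hα : -1 < α) (hy : 0 < y)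
    (ξ : EuclideanSpace ℝ (Fin n)) :
    angularFourier (fun x => (halfSpaceKernel n α x y : ℂ)) ξ =
      ((besselTail ((α + 1) / 2) 0 ((y * ‖ξ‖ / 2) ^ 2) / Real.Gamma ((α + 1) / 2) : ℝ) : ℂ) := by
  set ν := (α + 1) / 2 with hνdef
  have hν : 0 < ν := by rw [hνdef]; linarith
  set c : ℝ := y ^ (α + 1) / (Real.Gamma ν * Real.pi ^ ((n : ℝ) / 2)) with hc
  have hint : Integrable (Function.uncurry fun (x : EuclideanSpace ℝ (Fin n)) (t : ℝ) =>
      Complex.exp (-(Complex.I * ((inner ℝ x ξ : ℝ) : ℂ))) *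
        ((t ^ (ν + n / 2 - 1) * Real.exp (-((‖x‖ ^ 2 + y ^ 2) * t)) : ℝ) : ℂ))
      (volume.prod (volume.restrict (Set.Ioi 0))) := by
    -- The phase has modulus 1, so Fubini needs only the integrability of the positive mixture.
    refine (integrable_gaussian_mixture n hν hy).mono
      (Measurable.aestronglyMeasurable (by unfold Function.uncurry; fun_prop))
      (Eventually.of_forall fun p => ?_)
    rw [Function.uncurry, norm_mul, Complex.norm_real, ← mul_neg, mul_comm Complex.I,
      ← Complex.ofReal_neg, Complex.norm_exp_ofReal_mul_I, one_mul]
  have h1 (x : EuclideanSpace ℝ (Fin n)) :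
      Complex.exp (-(Complex.I * ((inner ℝ x ξ : ℝ) : ℂ))) * (halfSpaceKernel n α x y : ℂ) =
        c * ∫ t in Set.Ioi (0 : ℝ), Complex.exp (-(Complex.I * ((inner ℝ x ξ : ℝ) : ℂ))) *
          ((t ^ (ν + n / 2 - 1) * Real.exp (-((‖x‖ ^ 2 + y ^ 2) * t)) : ℝ) : ℂ) := by
    rw [halfSpaceKernel_eq_integral n hα hy, integral_const_mul, integral_complex_ofReal,
      Complex.ofReal_mul, hc]
    exact mul_left_comm _ _ _
  have h2 : ∫ t in Set.Ioi (0 : ℝ), ∫ x : EuclideanSpace ℝ (Fin n),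
      Complex.exp (-(Complex.I * ((inner ℝ x ξ : ℝ) : ℂ))) *
        ((t ^ (ν + n / 2 - 1) * Real.exp (-((‖x‖ ^ 2 + y ^ 2) * t)) : ℝ) : ℂ) =
      ((Real.pi ^ ((n : ℝ) / 2) *
        (y ^ (-(2 * ν)) * besselTail ν 0 ((y * ‖ξ‖ / 2) ^ 2)) : ℝ) : ℂ) := by
    rw [← integral_rpow_mul_exp_neg_mul_exp_neg_div ν hy, ← integral_const_mul,
      ← integral_complex_ofReal]
    refine setIntegral_congr_fun measurableSet_Ioi fun t ht => ?_
    have ht0 : 0 < t := ht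
    simp_rw [Complex.ofReal_mul (t ^ (ν + (n : ℝ) / 2 - 1)),
      mul_left_comm _ ((t ^ (ν + (n : ℝ) / 2 - 1) : ℝ) : ℂ)]
    rw [integral_const_mul, integral_cexp_inner_mul_exp_neg_mul_add n y ht0,
      ← Complex.ofReal_mul]
    congr 1
    rw [← mul_assoc (_ ^ _) (_ * _), ← mul_assoc (_ ^ _) (_ ^ _), ← rpow_mul_pi_div_rpow ν n ht0]
    ring
  unfold angularFourier
  simp_rw [h1]
  rw [integral_const_mul, integral_integral_swap hint, h2, ← Complex.ofReal_mul, hc,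
    show α + 1 = 2 * ν by rw [hνdef]; ring, Real.rpow_neg hy.le]
  congr 1
  have := (Real.rpow_pos_of_pos hy (2 * ν)).ne'
  have := (Real.rpow_pos_of_pos Real.pi_pos ((n : ℝ) / 2)).ne'
  have := (Real.Gamma_pos_of_pos hν).ne'
  field_simp

theorem theorem2p4 (n : ℕ) (hn : 0 < n) (α : ℝ) (hα : -1 < α) (y : ℝ) (hy : 0 < y) :
    -- the integral defining the Fourier transform converges absolutely
    Integrable (fun x : EuclideanSpace ℝ (Fin n) => halfSpaceKernel n α x y) ∧
    -- the formula away from the origin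
    (∀ ξ : EuclideanSpace ℝ (Fin n), ξ ≠ 0 →
      angularFourier (fun x => (halfSpaceKernel n α x y : ℂ)) ξ =
        ((2 ^ ((1 - α) / 2) / Real.Gamma ((α + 1) / 2) *
          (y * ‖ξ‖) ^ ((α + 1) / 2) * modifiedBesselK ((α + 1) / 2) (y * ‖ξ‖) : ℝ) : ℂ)) ∧
    -- the formula at the origin, where its right-hand side is read as a limit
    angularFourier (fun x => (halfSpaceKernel n α x y : ℂ)) (0 : EuclideanSpace ℝ (Fin n)) = 1 ∧
    Tendsto (fun r : ℝ => 2 ^ ((1 - α) / 2) / Real.Gamma ((α + 1) / 2) *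
      r ^ ((α + 1) / 2) * modifiedBesselK ((α + 1) / 2) r) (𝓝[>] 0) (𝓝 1) := by
  have hν : 0 < (α + 1) / 2 := by linarith
  rw [show (1 - α) / 2 = 1 - (α + 1) / 2 by ring]
  refine ⟨integrable_halfSpaceKernel n hα hy, fun ξ hξ => ?_, ?_,
    tendsto_two_rpow_mul_modifiedBesselK hν⟩
  · rw [angularFourier_halfSpaceKernel n hα hy,
      two_rpow_mul_modifiedBesselK hν (mul_pos hy (norm_pos_iff.2 hξ))]
  · rw [angularFourier_halfSpaceKernel n hα hy, norm_zero, mul_zero, zero_div,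
      zero_pow two_ne_zero, besselTail_zero_zero hν, div_self (Real.Gamma_pos_of_pos hν).ne',
      Complex.ofReal_one]
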